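/- Let $d\ge 2$ and let $S,F\ge 0$ be integers. Write $\|\cdot\|$ for the $L^\infty$ norm on $\mathbb{Z}^d$, and let $\mathbb{L}^d$ be the hypercubic lattice, i.e. the graph on $\mathbb{Z}^d$ whose edges join the pairs of points at $\ell^1$-distance $1$. Consider bond percolation of range $S$ on $\mathbb{Z}^d$: if $S\ge 1$, there is an edge between every pair $x,y\in\mathbb{Z}^d$ with $0<\|x-y\|\le S$; if $S=0$, the edges are those of $\mathbb{L}^d$ (the nearest-neighbour model). Each edge is independently open with probability $p\in[0,1]$ and closed otherwise; $\mathbb{P}^S_p$ is the corresponding probability measure, and open clusters are the connected components of the graph of open edges. Let $$p_c^S=\inf\{p\in[0,1]: \mathbb{P}_p^S(\text{there is an infinite open cluster})>0\}.$$ Let $I$ be the set of vertices lying in infinite open clusters, and let $$X^F=\{x\in\mathbb{Z}^d: \|x-y\|>F\text{ for all }y\in I\}.$$ Let $\mathcal{T}^F$ be the event that the subgraph of $\mathbb{L}^d$ induced by $X^F$ has an infinite connected component, and let $$p_{\mathrm{fin}}^S(F)=\sup\{p\in[0,1]:\mathbb{P}^S_p(\mathcal{T}^F)>0\}.$$ Let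 $\mathrm{rad}(C)=\sup\{\|x\|: x\in C\}\in[0,\infty]$ be the radius of the open cluster $C$ of the origin. Then there exists $c>0$ (depending only on $d$, $S$ and $F$) such that the following holds. If $$\mathbb{P}^S_{p_c^S}(\mathrm{rad}(C)\ge n)\le \frac{c}{n}\qquad\text{for all sufficiently large } n,$$ then $p_c^S<p_{\mathrm{fin}}^S(F)$. -/

import Mathlib

open MeasureTheory Filter Topology
open scoped ENNReal unitInterval

namespace Perc

/-- The hypercubic lattice on `ℤ^d`: `x` and `y` are adjacent iff their `ℓ¹` distance is `1`. -/
def lattice (d : ℕ) : SimpleGraph (Fin d → ℤ) where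
  Adj x y := ∑ i, |x i - y i| = 1
  symm := ⟨fun x y h => by simpa only [abs_sub_comm] using h⟩
  loopless := ⟨fun x h => by simp at h⟩

/-- The edges on which percolation of range `S` lives. For `S ≥ 1`, all pairs `x, y` with
`0 < ‖x - y‖ ≤ S`, where `‖·‖` is the sup norm (`dist` on `Fin d → ℤ` is the sup distance);
`S = 0` stands for the nearest-neighbour model. -/
def spreadOut (d S : ℕ) : SimpleGraph (Fin d → ℤ) where
  Adj x y := if S = 0 then (lattice d).Adj x y else 0 < dist x y ∧ dist x y ≤ (S : ℝ)
  symm := ⟨fun x y h => by simpa only [dist_comm, (lattice d).adj_comm] using h⟩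
  loopless := ⟨fun x h => by simp at h⟩

/-- Configurations: every edge is open (`true`) or closed (`false`). -/
abbrev Config (d S : ℕ) : Type := (spreadOut d S).edgeSet → Bool

/-- The law `P_p^S`: each edge is independently open with probability `p`. -/
noncomputable def law (d S : ℕ) (p : I) : Measure (Config d S) :=
  Measure.infinitePi fun _ => ProbabilityTheory.bernoulliMeasure true false p

/-- The graph of open edges. -/
def openGraph {d S : ℕ} (ω : Config d S) : SimpleGraph (Fin d → ℤ) where
  Adj x y := ∃ h : s(x, y) ∈ (spreadOut d S).edgeSet, ω ⟨s(x, y), h⟩ = true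
  symm := ⟨fun x y h => by simpa only [Sym2.eq_swap] using h⟩
  loopless := ⟨fun x ⟨h, _⟩ => (spreadOut d S).loopless.irrefl x h⟩

/-- The open cluster of `x`. -/
def cluster {d S : ℕ} (ω : Config d S) (x : Fin d → ℤ) : Set (Fin d → ℤ) :=
  {y | (openGraph ω).Reachable x y}

/-- The set of vertices that lie in infinite open clusters. -/
def infSet {d S : ℕ} (ω : Config d S) : Set (Fin d → ℤ) :=
  {x | (cluster ω x).Infinite}

/-- The critical probability: the infimum, over `p ∈ [0,1]`, of those `p` for which there is an
infinite open cluster with strictly positive probability. -/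
noncomputable def pc (d S : ℕ) : I :=
  sInf {p : I | 0 < law d S p {ω | (infSet ω).Nonempty}}

/-- The vertices that are not within sup distance `F` of an infinite open cluster. -/
def avoid {d S : ℕ} (F : ℕ) (ω : Config d S) : Set (Fin d → ℤ) :=
  {x | ∃ y ∈ infSet ω, dist x y ≤ (F : ℝ)}ᶜ

/-- The event that the subgraph of the lattice (with nearest-neighbour edges) induced by
`avoid F ω` has an infinite connected component. -/
def finEvent (d S F : ℕ) : Set (Config d S) :=
  {ω | ∃ K : ((lattice d).induce (avoid F ω)).ConnectedComponent, K.supp.Infinite}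

/-- The threshold `p_fin^S(F)`, a supremum over `p ∈ [0,1]`. -/
noncomputable def pfin (d S F : ℕ) : I :=
  sSup {p : I | 0 < law d S p (finEvent d S F)}

/-- The radius, in the sup norm, of the open cluster at the origin; it may be infinite. -/
noncomputable def rad {d S : ℕ} (ω : Config d S) : ℝ≥0∞ :=
  ⨆ x ∈ cluster ω 0, ‖x‖ₑ

end Perc

/-! The hypothesis is used at a single large scale `n`. Reaching distance `n` depends on finitely
many edges, so its probability is continuous in the parameter: the bound `c / n` at criticality
yields some `p > p_c` at which it is still at most `2c / n`. At this `p` the complement of the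
infinite clusters is shown to percolate in a coordinate plane.

Place at each site of `n ℤ²` a cross made of `O(n)` lattice points, and call the site bad if a
vertex within `F` of the cross has an arm of length `n`. A vertex of an infinite cluster has arms of
every length, so a good cross lies in `avoid F ω`. By a union bound a site is bad with probability
`O(n) * (2c / n)`, which is as small as desired, uniformly in `n`, once `c` is small. Badness has
finite range in units of `n`, so many given sites are all bad with exponentially small probability
(`law_biInter_badSite_le`).

A Peierls argument then gives a Lipschitz curve of good sites
(`measure_not_exists_lipschitz_curve`). Consider paths from the lower half-plane that step up only
onto bad sites and otherwise diagonally down. Reaching a great height requires many bad sites, so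
the heights reached in a column are bounded, and the sites just above the highest ones form the
curve. Consecutive crosses along it meet, which produces an infinite component. -/

namespace Perc

/-! ### Cylinder events under product Bernoulli measure -/

section Product

variable {ι : Type*}

/-- An event that depends on finitely many coordinates is a cylinder. -/
lemma exists_eq_restrict_preimage {s : Finset ι} {A : Set (ι → Bool)}
    (hA : DependsOn (· ∈ A) (s : Set ι)) : ∃ B : Set (s → Bool), A = s.restrict ⁻¹' B := by
  refine ⟨s.restrict '' A, Set.Subset.antisymm (Set.subset_preimage_image _ _) ?_⟩
  rintro ω ⟨ω', hω', h⟩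
  have := hA (x := ω') (y := ω) fun i hi => congrFun h ⟨i, hi⟩
  exact this.mp hω'

lemma measurableSet_of_dependsOn {s : Finset ι} {A : Set (ι → Bool)}
    (hA : DependsOn (· ∈ A) (s : Set ι)) : MeasurableSet A := by
  obtain ⟨B, rfl⟩ := exists_eq_restrict_preimage hA
  exact Finset.measurable_restrict s (Set.toFinite B).measurableSet

/-- The probability of a cylinder event is continuous in the parameter. -/
lemma continuous_measureReal_of_dependsOn {s : Finset ι} {A : Set (ι → Bool)}
    (hA : DependsOn (· ∈ A) (s : Set ι)) :
    Continuous fun p : I => (Measure.infinitePi fun _ : ι =>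
      ProbabilityTheory.bernoulliMeasure true false p).real A := by
  classical
  obtain ⟨B, rfl⟩ := exists_eq_restrict_preimage hA
  -- Summing over the finitely many local configurations shows that the probability is a polynomial
  -- in `p`.
  have key : ∀ p : I, (Measure.infinitePi fun _ : ι =>
      ProbabilityTheory.bernoulliMeasure true false p).real (s.restrict ⁻¹' B) =
      ∑ x ∈ B.toFinite.toFinset, ∏ i : s, if x i = true then (p : ℝ) else 1 - p := by
    intro p
    rw [← map_measureReal_apply (Finset.measurable_restrict s) (Set.toFinite B).measurableSet,
      Measure.infinitePi_map_restrict]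
    conv_lhs => rw [← B.toFinite.coe_toFinset, ← sum_measureReal_singleton]
    refine Finset.sum_congr rfl fun x _ => ?_
    rw [measureReal_def, Measure.pi_singleton, ENNReal.toReal_prod]
    refine Finset.prod_congr rfl fun i _ => ?_
    rw [← measureReal_def, ProbabilityTheory.bernoulliMeasure_real_apply p (measurableSet_singleton _)]
    cases x i <;> simp
  simp_rw [key]
  refine continuous_finsetSum _ fun x _ => continuous_finsetProd _ fun i _ => ?_
  split_ifs <;> fun_prop

/-- Events that depend on disjoint finite sets of coordinates are independent. -/
lemma measure_inter_of_dependsOn (p : I) {s t : Finset ι} {A B : Set (ι → Bool)}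
    (hA : DependsOn (· ∈ A) (s : Set ι)) (hB : DependsOn (· ∈ B) (t : Set ι))
    (hst : Disjoint s t) :
    (Measure.infinitePi fun _ : ι => ProbabilityTheory.bernoulliMeasure true false p) (A ∩ B) =
    (Measure.infinitePi fun _ : ι => ProbabilityTheory.bernoulliMeasure true false p) A *
    (Measure.infinitePi fun _ : ι => ProbabilityTheory.bernoulliMeasure true false p) B := by
  obtain ⟨A, rfl⟩ := exists_eq_restrict_preimage hA
  obtain ⟨B, rfl⟩ := exists_eq_restrict_preimage hB
  have h := (ProbabilityTheory.iIndepFun_infinitePi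
    (P := fun _ : ι => ProbabilityTheory.bernoulliMeasure true false p)
    (X := fun _ x => x) fun _ => measurable_id).indepFun_finset s t hst
      fun i => measurable_pi_apply i
  exact h.measure_inter_preimage_eq_mul _ _ (Set.toFinite A).measurableSet
    (Set.toFinite B).measurableSet

/-- Finitely many events of probability at most `q` that depend on pairwise disjoint sets of
coordinates occur together with probability at most `q ^ card`. -/
lemma measure_biInter_le_pow {α : Type*} (p : I) (A : α → Set (ι → Bool)) (s : α → Finset ι)
    (hA : ∀ a, DependsOn (· ∈ A a) (s a : Set ι)) {q : ℝ≥0∞}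
    (hq : ∀ a, (Measure.infinitePi fun _ : ι =>
      ProbabilityTheory.bernoulliMeasure true false p) (A a) ≤ q)
    (T : Finset α) (hT : (T : Set α).PairwiseDisjoint s) :
    (Measure.infinitePi fun _ : ι => ProbabilityTheory.bernoulliMeasure true false p)
      (⋂ a ∈ T, A a) ≤ q ^ T.card := by
  classical
  induction T using Finset.induction_on with
  | empty => simp
  | insert a T ha ih =>
    rw [Finset.set_biInter_insert, measure_inter_of_dependsOn p (hA a) (t := T.biUnion s),
      Finset.card_insert_of_notMem ha, pow_succ']
    · refine mul_le_mul' (hq a) (ih (hT.subset ?_))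
      simp
    · intro x y h
      simp only [Set.mem_iInter, eq_iff_iff]
      refine forall₂_congr fun b hb => ?_
      exact (hA b fun i hi => h i (by simpa using ⟨b, hb, hi⟩)).to_iff
    · rw [Finset.disjoint_biUnion_right]
      intro b hb
      refine hT (by simp) (by simp [hb]) ?_
      rintro rfl
      exact ha hb

end Product

/-! ### Arm events: locality, translation, continuity -/

section Arms

variable {d S : ℕ}

instance (p : I) : IsProbabilityMeasure (law d S p) := by
  unfold law; infer_instance

lemma dist_le_one_of_lattice_adj {x y : Fin d → ℤ} (h : (lattice d).Adj x y) : dist x y ≤ 1 := by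
  refine (dist_pi_le_iff zero_le_one).2 fun i => ?_
  rw [Int.dist_eq]
  have h1 : |x i - y i| ≤ 1 :=
    (Finset.single_le_sum (f := fun i => |x i - y i|) (fun _ _ => abs_nonneg _)
      (Finset.mem_univ i)).trans_eq h
  exact_mod_cast h1

lemma spreadOut_adj_of_lattice_adj {x y : Fin d → ℤ} (h : (lattice d).Adj x y) :
    (spreadOut d S).Adj x y := by
  by_cases hS : S = 0
  · simpa [spreadOut, hS] using h
  · have h1 : (1 : ℝ) ≤ S := by exact_mod_cast Nat.one_le_iff_ne_zero.2 hS
    simpa only [spreadOut, hS, if_false] using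
      ⟨dist_pos.2 h.ne, (dist_le_one_of_lattice_adj h).trans h1⟩

lemma dist_le_of_spreadOut_adj {n : ℕ} (hn : 1 ≤ n) (hS : S ≤ n) {x y : Fin d → ℤ}
    (h : (spreadOut d S).Adj x y) : dist x y ≤ n := by
  by_cases hS0 : S = 0
  · have h' : (lattice d).Adj x y := by simpa [spreadOut, hS0] using h
    exact (dist_le_one_of_lattice_adj h').trans (by exact_mod_cast hn)
  · have h' : 0 < dist x y ∧ dist x y ≤ (S : ℝ) := by
      simpa only [spreadOut, hS0, if_false] using h
    exact h'.2.trans (by exact_mod_cast hS)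

lemma spreadOut_adj_add_right (x y z : Fin d → ℤ) :
    (spreadOut d S).Adj (x + z) (y + z) ↔ (spreadOut d S).Adj x y := by
  simp only [spreadOut, lattice, Pi.add_apply, add_sub_add_right_eq_sub, dist_add_right]

lemma finite_setOf_dist_le (c : Fin d → ℤ) (R : ℝ) : {w | dist c w ≤ R}.Finite := by
  have h := (isCompact_closedBall c R).finite_of_discrete
  refine h.subset fun w hw => ?_
  simpa [dist_comm] using hw

lemma finite_setOf_edges (d S : ℕ) (c : Fin d → ℤ) (R : ℝ) :
    {e : (spreadOut d S).edgeSet | ∀ w ∈ e.1, dist c w ≤ R}.Finite := by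
  have h := finite_setOf_dist_le c R
  refine Set.Finite.of_finite_image (f := Subtype.val) (((h.prod h).image
    (fun q : (Fin d → ℤ) × (Fin d → ℤ) => s(q.1, q.2))).subset ?_) Subtype.val_injective.injOn
  rintro _ ⟨⟨e, he⟩, h', rfl⟩
  induction e with
  | h x y => exact ⟨(x, y), ⟨h' x (by simp), h' y (by simp)⟩, rfl⟩

/-- The edges with both endpoints within distance `R` of `c`. -/
noncomputable def edgesIn (d S : ℕ) (c : Fin d → ℤ) (R : ℝ) : Finset (spreadOut d S).edgeSet :=
  (finite_setOf_edges d S c R).toFinset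

lemma mem_edgesIn {c : Fin d → ℤ} {R : ℝ} {e : (spreadOut d S).edgeSet} :
    e ∈ edgesIn d S c R ↔ ∀ w ∈ e.1, dist c w ≤ R := by
  simp [edgesIn]

lemma disjoint_edgesIn {c c' : Fin d → ℤ} {R : ℝ} (h : 2 * R < dist c c') :
    Disjoint (edgesIn d S c R) (edgesIn d S c' R) := by
  rw [Finset.disjoint_left]
  intro e h1 h2
  rw [mem_edgesIn] at h1 h2
  obtain ⟨⟨x, y⟩, he⟩ := e
  have h1 := h1 x (Sym2.mem_mk_left x y)
  have h2 := h2 x (Sym2.mem_mk_left x y)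
  linarith [dist_triangle_right c c' x]

/-- The event that the cluster of `y` reaches distance `n` from `y`. -/
def arm (S n : ℕ) (y : Fin d → ℤ) : Set (Config d S) :=
  {ω | ∃ z ∈ cluster ω y, (n : ℝ) ≤ dist y z}

/-- Follow an open path from `y` up to its first vertex at distance at least `n`. Each edge used
starts within `n` of `y` and has length at most `n`, so it stays within `2 * n` of `y`. -/
lemma mem_arm_of_agree {n : ℕ} (hn : 1 ≤ n) (hS : S ≤ n) {y c : Fin d → ℤ} {R : ℝ}
    (hR : dist c y + 2 * n ≤ R) {ω ω' : Config d S} (h : ∀ e ∈ edgesIn d S c R, ω e = ω' e)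
    (hω : ω ∈ arm S n y) : ω' ∈ arm S n y := by
  by_contra hω'
  obtain ⟨z, hz, hnz⟩ := hω
  suffices z ∈ cluster ω' y from hω' ⟨z, this, hnz⟩
  clear hnz
  rw [cluster, Set.mem_ofPred_eq, SimpleGraph.reachable_iff_reflTransGen] at hz
  induction hz with
  | refl => exact SimpleGraph.Reachable.refl y
  | @tail u w _ huw ih =>
    by_cases hu : (n : ℝ) ≤ dist y u
    · exact absurd ⟨u, ih, hu⟩ hω'
    refine SimpleGraph.Reachable.trans ih (SimpleGraph.Adj.reachable ?_)
    obtain ⟨he, ho⟩ := huw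
    refine ⟨he, (h _ ?_).symm.trans ho⟩
    rw [mem_edgesIn]
    have huw' := dist_le_of_spreadOut_adj hn hS ((SimpleGraph.mem_edgeSet _).1 he)
    have h0 : (0 : ℝ) ≤ n := n.cast_nonneg
    intro v hv
    rcases Sym2.mem_iff.1 hv with rfl | rfl
    · linarith [dist_triangle c y v]
    · linarith [dist_triangle4 c y u v]

lemma dependsOn_arm {n : ℕ} (hn : 1 ≤ n) (hS : S ≤ n) {y c : Fin d → ℤ} {R : ℝ}
    (hR : dist c y + 2 * n ≤ R) :
    DependsOn (· ∈ arm S n y) (edgesIn d S c R : Set (spreadOut d S).edgeSet) := by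
  intro ω ω' h
  exact propext ⟨mem_arm_of_agree hn hS hR h, mem_arm_of_agree hn hS hR fun e he => (h e he).symm⟩

/-- Translation of edges by `y`. -/
def shiftEdge (S : ℕ) (y : Fin d → ℤ) (e : (spreadOut d S).edgeSet) : (spreadOut d S).edgeSet :=
  ⟨e.1.map (· + y), by
    obtain ⟨e, he⟩ := e
    induction e with
    | h u v => exact (spreadOut_adj_add_right u v y).2 he⟩

lemma shiftEdge_injective (y : Fin d → ℤ) : Function.Injective (shiftEdge S y) := by
  intro e e' h
  exact Subtype.ext (Sym2.map.injective (add_left_injective y) (congrArg Subtype.val h))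

lemma arm_subset_preimage (n : ℕ) (y : Fin d → ℤ) :
    arm S n y ⊆ (fun (ω : Config d S) e => ω (shiftEdge S y e)) ⁻¹' arm S n 0 := by
  rintro ω ⟨z, hz, hnz⟩
  refine ⟨z - y, ?_, by simpa [dist_eq_norm, norm_sub_rev] using hnz⟩
  let f : openGraph ω →g openGraph (fun e => ω (shiftEdge S y e)) :=
    { toFun := fun w => w - y
      map_rel' := by
        rintro u w ⟨he, ho⟩
        refine ⟨?_, ?_⟩
        · have := (SimpleGraph.mem_edgeSet _).1 he
          rw [SimpleGraph.mem_edgeSet, ← spreadOut_adj_add_right _ _ y]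
          simpa using this
        · convert ho using 2
          simp [shiftEdge] }
  have := SimpleGraph.Reachable.map f hz
  rw [show f y = 0 from sub_self y] at this
  exact this

lemma law_arm_le (p : I) {n : ℕ} (hn : 1 ≤ n) (hS : S ≤ n) (y : Fin d → ℤ) :
    law d S p (arm S n y) ≤ law d S p (arm S n 0) := by
  refine (measure_mono (arm_subset_preimage n y)).trans_eq ?_
  rw [← Measure.map_apply (by fun_prop)
    (measurableSet_of_dependsOn (dependsOn_arm hn hS (c := 0) le_rfl)), law,
    Measure.map_infinitePi_infinitePi_of_inj (shiftEdge_injective y)]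

lemma arm_subset_rad (n : ℕ) : arm S n (0 : Fin d → ℤ) ⊆ {ω | (n : ℝ≥0∞) ≤ rad ω} := by
  rintro ω ⟨z, hz, hnz⟩
  refine le_trans ?_ (le_iSup₂ (f := fun x (_ : x ∈ cluster ω 0) => ‖x‖ₑ) z hz)
  rw [dist_zero_left] at hnz
  rw [← ofReal_norm, ← ENNReal.ofReal_natCast]
  exact ENNReal.ofReal_le_ofReal hnz

/-- This replaces the nonlocal event of an infinite cluster by a local one. -/
lemma mem_arm_of_mem_infSet {ω : Config d S} {y : Fin d → ℤ} (h : y ∈ infSet ω) (n : ℕ) :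
    ω ∈ arm S n y := by
  by_contra hn
  refine h ((finite_setOf_dist_le y n).subset fun z hz => ?_)
  by_contra hz'
  exact hn ⟨z, hz, (not_le.1 hz').le⟩

lemma continuous_law_arm {n : ℕ} (hn : 1 ≤ n) (hS : S ≤ n) (y : Fin d → ℤ) :
    Continuous fun p : I => (law d S p).real (arm S n y) :=
  continuous_measureReal_of_dependsOn (dependsOn_arm hn hS (c := y) le_rfl)

end Arms

/-! ### A coordinate plane, and the fully open configuration -/

section Plane

variable {d S : ℕ}

/-- The embedding of the square lattice as a coordinate plane of `ℤ^d`. -/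
def emb (d : ℕ) (a b : ℤ) : Fin d → ℤ :=
  fun i => if i.1 = 0 then a else if i.1 = 1 then b else 0

lemma lattice_adj_emb_fst (hd : 2 ≤ d) (a b : ℤ) :
    (lattice d).Adj (emb d a b) (emb d (a + 1) b) := by
  change ∑ i, |emb d a b i - emb d (a + 1) b i| = 1
  rw [Finset.sum_eq_single ⟨0, by omega⟩]
  · simp [emb]
  · intro i _ hi
    have : i.1 ≠ 0 := fun h => hi (Fin.ext h)
    simp [emb, this]
  · simp

lemma lattice_adj_emb_snd (hd : 2 ≤ d) (a b : ℤ) :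
    (lattice d).Adj (emb d a b) (emb d a (b + 1)) := by
  change ∑ i, |emb d a b i - emb d a (b + 1) i| = 1
  rw [Finset.sum_eq_single ⟨1, by omega⟩]
  · simp [emb]
  · intro i _ hi
    have : i.1 ≠ 1 := fun h => hi (Fin.ext h)
    simp [emb, this]
  · simp

lemma abs_fst_le_dist_emb (hd : 2 ≤ d) (a b a' b' : ℤ) :
    (|a - a'| : ℝ) ≤ dist (emb d a b) (emb d a' b') := by
  have := dist_le_pi_dist (emb d a b) (emb d a' b') ⟨0, by omega⟩
  simpa [emb, Int.dist_eq] using this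

lemma abs_snd_le_dist_emb (hd : 2 ≤ d) (a b a' b' : ℤ) :
    (|b - b'| : ℝ) ≤ dist (emb d a b) (emb d a' b') := by
  have := dist_le_pi_dist (emb d a b) (emb d a' b') ⟨1, by omega⟩
  simpa [emb, Int.dist_eq] using this

lemma dist_emb_le {a b a' b' : ℤ} {R : ℝ} (h0 : 0 ≤ R) (h1 : |(a : ℝ) - a'| ≤ R)
    (h2 : |(b : ℝ) - b'| ≤ R) : dist (emb d a b) (emb d a' b') ≤ R := by
  refine (dist_pi_le_iff h0).2 fun i => ?_
  rw [Int.dist_eq]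
  by_cases hi : i.1 = 0
  · simpa [emb, hi] using h1
  · by_cases hi' : i.1 = 1
    · simpa [emb, hi'] using h2
    · simpa [emb, hi, hi'] using h0

/-- This rules out `p_c = 1` under the one-arm hypothesis, leaving room for a larger parameter. -/
lemma law_one_arm (hd : 2 ≤ d) (n : ℕ) : (law d S 1).real (arm S n 0) = 1 := by
  have h : law d S 1 = Measure.dirac fun _ => true := by
    simp [law]
  have hmem : (fun _ => true : Config d S) ∈ arm S n 0 := by
    have hreach : ∀ k : ℕ, emb d k 0 ∈ cluster (fun _ => true : Config d S) 0 := by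
      intro k
      induction k with
      | zero =>
        have : emb d ((0 : ℕ) : ℤ) 0 = 0 := by ext i; simp [emb]
        rw [this]
        exact SimpleGraph.Reachable.refl _
      | succ k ih =>
        refine SimpleGraph.Reachable.trans ih (SimpleGraph.Adj.reachable ?_)
        have := lattice_adj_emb_fst hd k 0
        exact ⟨spreadOut_adj_of_lattice_adj (by exact_mod_cast this), rfl⟩
    refine ⟨_, hreach n, ?_⟩
    have := abs_fst_le_dist_emb hd 0 0 n 0
    have h0 : emb d 0 0 = 0 := by ext i; simp [emb]
    rw [h0] at this
    simpa using this
  rw [h, measureReal_def, Measure.dirac_apply_of_mem hmem, ENNReal.toReal_one]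

end Plane

/-! ### Lipschitz curves by a Peierls argument -/

section Lipschitz

/-- The increments of the paths used to construct Lipschitz curves. -/
def stepVec : Fin 3 → ℤ × ℤ := ![(0, 1), (-1, -1), (1, -1)]

/-- One step of a path: upwards onto a site of `B`, or diagonally downwards. -/
def Step (B : Set (ℤ × ℤ)) (u v : ℤ × ℤ) : Prop :=
  ∃ j, v = u + stepVec j ∧ (j = 0 → v ∈ B)

/-- The site `v` is the endpoint of a path from the lower half-plane. -/
def Reach (B : Set (ℤ × ℤ)) (v : ℤ × ℤ) : Prop :=
  ∃ u : ℤ × ℤ, u.2 ≤ 0 ∧ Relation.ReflTransGen (Step B) u v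

lemma Reach.step {B : Set (ℤ × ℤ)} {u v : ℤ × ℤ} (hu : Reach B u) (h : Step B u v) :
    Reach B v := by
  obtain ⟨w, hw, hwu⟩ := hu
  exact ⟨w, hw, hwu.tail h⟩

lemma Reach.left {B : Set (ℤ × ℤ)} {x h : ℤ} (hr : Reach B (x + 1, h)) : Reach B (x, h - 1) :=
  hr.step ⟨1, by simp [stepVec, sub_eq_add_neg], by simp⟩

lemma Reach.right {B : Set (ℤ × ℤ)} {x h : ℤ} (hr : Reach B (x, h)) : Reach B (x + 1, h - 1) :=
  hr.step ⟨2, by simp [stepVec, sub_eq_add_neg], by simp⟩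

/-- If the heights reached in one column are bounded, there is a Lipschitz curve avoiding `B`. -/
lemma exists_lipschitz_curve {B : Set (ℤ × ℤ)} (hB : ∀ᶠ h : ℕ in atTop, ¬ Reach B (0, h)) :
    ∃ L : ℕ → ℤ, ∀ x : ℕ, ((x : ℤ), L x) ∉ B ∧ |L x - L (x + 1)| ≤ 1 := by
  -- Diagonal steps carry a height `h` in one column to `h - 1` in the next, so a bound in one
  -- column gives a bound larger by one in its neighbour.
  have hbdd : ∀ x : ℕ, ∃ M : ℤ, ∀ h, Reach B (x, h) → h ≤ M := by
    intro x
    induction x with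
    | zero =>
      obtain ⟨M, hM⟩ := eventually_atTop.1 hB
      refine ⟨M, fun h hr => ?_⟩
      by_contra! hlt
      refine hM h.toNat (by omega) ?_
      rwa [Int.toNat_of_nonneg (by omega)]
    | succ x ih =>
      obtain ⟨M, hM⟩ := ih
      refine ⟨M + 1, fun h hr => ?_⟩
      have := hM (h - 1) (Reach.left (by exact_mod_cast hr))
      omega
  have hmax : ∀ x : ℕ, ∃ g : ℤ, Reach B (x, g) ∧ ∀ h, Reach B (x, h) → h ≤ g := fun x =>
    Int.exists_greatest_of_bdd (hbdd x) ⟨0, (x, 0), le_rfl, .refl⟩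
  choose g hg hgmax using hmax
  -- A bad site directly above the highest reached one would itself be reached. The diagonal steps
  -- give the Lipschitz bound.
  refine ⟨fun x => g x + 1, fun x => ⟨fun hx => ?_, ?_⟩⟩
  · have := hgmax x (g x + 1) ((hg x).step ⟨0, by simp [stepVec], fun _ => hx⟩)
    omega
  · dsimp only
    have h1 := hgmax (x + 1) (g x - 1) (by exact_mod_cast (hg x).right)
    have h2 := hgmax x (g (x + 1) - 1) (Reach.left (by exact_mod_cast hg (x + 1)))
    rw [abs_le]
    omega

/-- A path of length `N` to `v`, listed backwards. -/
def BackPath (B : Set (ℤ × ℤ)) (v : ℤ × ℤ) (N : ℕ) (f : ℕ → ℤ × ℤ) : Prop :=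
  f 0 = v ∧ (f N).2 ≤ 0 ∧ ∀ i < N, Step B (f (i + 1)) (f i)

lemma Reach.exists_backPath {B : Set (ℤ × ℤ)} {v : ℤ × ℤ} (h : Reach B v) :
    ∃ N f, BackPath B v N f := by
  obtain ⟨u, hu, huv⟩ := h
  induction huv with
  | refl => exact ⟨0, fun _ => u, rfl, hu, by simp⟩
  | @tail w v _ hwv ih =>
    obtain ⟨N, f, h0, hN, hf⟩ := ih
    refine ⟨N + 1, fun i => Nat.casesOn i v f, rfl, hN, ?_⟩
    rintro (_ | i) hi
    · simpa [h0] using hwv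
    · exact hf i (by omega)

/-- A shortest path visits distinct sites. -/
lemma Reach.exists_injOn_backPath {B : Set (ℤ × ℤ)} {v : ℤ × ℤ} (h : Reach B v) :
    ∃ N f, BackPath B v N f ∧ Set.InjOn f (Set.Iio N) := by
  classical
  have hex := h.exists_backPath
  obtain ⟨f, hf⟩ := Nat.find_spec hex
  refine ⟨Nat.find hex, f, hf, ?_⟩
  set N := Nat.find hex with hN
  have key : ∀ i j, i < j → j < N → f i ≠ f j := by
    intro i j hij hj heq
    obtain ⟨h0, hN0, hs⟩ := hf
    -- Excising the loop between the visits `i` and `j` would give a shorter path.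
    refine Nat.find_min hex (m := N - (j - i)) (by omega)
      ⟨fun k => if k ≤ i then f k else f (k + (j - i)), by simpa using h0, ?_, ?_⟩
    · dsimp only
      rw [if_neg (by omega), show N - (j - i) + (j - i) = N by omega]
      exact hN0
    · intro k hk
      dsimp only
      rcases lt_trichotomy k i with hki | rfl | hki
      · rw [if_pos (by omega), if_pos (by omega)]
        exact hs k (by omega)
      · rw [if_neg (by omega), if_pos le_rfl, heq, show k + 1 + (j - k) = j + 1 by omega]
        exact hs j hj
      · rw [if_neg (by omega), if_neg (by omega),
          show k + 1 + (j - i) = k + (j - i) + 1 by omega]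
        exact hs _ (by omega)
  intro i hi j hj heq
  rcases lt_trichotomy i j with h | h | h
  · exact absurd heq (key i j h hj)
  · exact h
  · exact absurd heq.symm (key j i h hi)

/-- The `k`-th site of the backward path from `(0, h)` with the increments `s`. -/
def backSite (h : ℤ) {N : ℕ} (s : Fin N → Fin 3) (k : ℕ) : ℤ × ℤ :=
  (0, h) - ∑ i : Fin N with i.1 < k, stepVec (s i)

/-- The sites that are entered by an upward step. -/
def upSites (h : ℤ) {N : ℕ} (s : Fin N → Fin 3) : Finset (ℤ × ℤ) :=
  ({i | s i = 0} : Finset (Fin N)).image fun i : Fin N => backSite h s i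

/-- Upward steps gain one unit of height and the others lose one. A path from height at most `0` to
height `h` thus has at least `(N + h) / 2` upward steps, and along a shortest path they enter
distinct sites of `B`. -/
lemma Reach.exists_upSites {B : Set (ℤ × ℤ)} {h : ℕ} (hr : Reach B (0, h)) :
    ∃ N ≥ h, ∃ s : Fin N → Fin 3, N ≤ 2 * (upSites h s).card ∧
      (upSites h s : Set (ℤ × ℤ)) ⊆ B := by
  obtain ⟨N, f, ⟨h0, hN, hs⟩, hinj⟩ := hr.exists_injOn_backPath
  choose s hs hsB using fun i : Fin N => hs i i.2
  have hsite : ∀ k ≤ N, f k = backSite h s k := by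
    intro k
    induction k with
    | zero => intro _; simp [backSite, h0]
    | succ k ih =>
      intro hk
      have h1 := hs ⟨k, hk⟩
      have h2 : ({i | i.1 < k + 1} : Finset (Fin N)) =
          insert ⟨k, hk⟩ ({i | i.1 < k} : Finset (Fin N)) := by
        ext i
        simp [Fin.ext_iff]
        omega
      have h3 : backSite h s (k + 1) = backSite h s k - stepVec (s ⟨k, hk⟩) := by
        simp only [backSite]
        rw [h2, Finset.sum_insert (by simp), add_comm, ← sub_sub]
      rw [h3, ← ih (by omega), h1, add_sub_cancel_right]
  have hcard : (upSites h s).card = ({i | s i = 0} : Finset (Fin N)).card := by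
    refine Finset.card_image_of_injOn fun i _ j _ hij => ?_
    simp only [← hsite _ i.2.le, ← hsite _ j.2.le] at hij
    exact Fin.ext (hinj i.2 j.2 hij)
  have hheight : (h : ℤ) + N ≤ 2 * ({i | s i = 0} : Finset (Fin N)).card := by
    have h1 : (f N).2 = h - ∑ i : Fin N, (stepVec (s i)).2 := by
      rw [hsite N le_rfl, backSite, Prod.snd_sub, Prod.snd_sum]
      simp
    have h2 : ∀ j : Fin 3, (stepVec j).2 = 2 * (if j = 0 then 1 else 0) - 1 := by
      intro j
      fin_cases j <;> simp [stepVec]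
    simp_rw [h2] at h1
    rw [Finset.sum_sub_distrib, ← Finset.mul_sum, Finset.sum_boole] at h1
    simp at h1
    omega
  have hle : ({i | s i = 0} : Finset (Fin N)).card ≤ N := by
    simpa using Finset.card_le_univ ({i | s i = 0} : Finset (Fin N))
  refine ⟨N, by omega, s, by omega, ?_⟩
  intro v hv
  simp only [upSites, Finset.coe_image, Set.mem_image, Finset.mem_coe, Finset.mem_filter] at hv
  obtain ⟨i, ⟨_, hi⟩, rfl⟩ := hv
  rw [← hsite _ i.2.le]
  exact hsB i hi

/-- If many bad sites are exponentially unlikely, then almost surely there is a Lipschitz curve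
that avoids the bad sites. -/
lemma measure_not_exists_lipschitz_curve {Ω : Type*} [MeasurableSpace Ω] (μ : Measure Ω)
    (A : ℤ × ℤ → Set Ω)
    (hA : ∀ T : Finset (ℤ × ℤ), μ (⋂ v ∈ T, A v) ≤ (1 / 12) ^ (2 * T.card)) :
    μ {ω | ¬ ∃ L : ℕ → ℤ, ∀ x : ℕ, ω ∉ A (x, L x) ∧ |L x - L (x + 1)| ≤ 1} = 0 := by
  let G : ℕ → Set Ω := fun N => ⋃ h ∈ Finset.range (N + 1), ⋃ s : Fin N → Fin 3,
    ⋃ _ : N ≤ 2 * (upSites h s).card, ⋂ v ∈ upSites h s, A v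
  have hG : ∀ N, μ (G N) ≤ (1 / 2) ^ N := by
    intro N
    have h1 : ∀ (h : ℕ) (s : Fin N → Fin 3),
        μ (⋃ _ : N ≤ 2 * (upSites h s).card, ⋂ v ∈ upSites h s, A v) ≤ (1 / 12) ^ N := by
      intro h s
      by_cases hc : N ≤ 2 * (upSites h s).card
      · simp only [hc, Set.iUnion_true]
        refine (hA _).trans (pow_le_pow_of_le_one zero_le ?_ hc)
        simp
      · simp [hc]
    -- There are `N + 1` heights and `3 ^ N` sequences of increments, each costing `12 ^ (-N)`.
    calc μ (G N) ≤ ∑ h ∈ Finset.range (N + 1), ∑ s : Fin N → Fin 3, (1 / 12 : ℝ≥0∞) ^ N :=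
          (measure_biUnion_finset_le _ _).trans <| Finset.sum_le_sum fun h _ =>
            (measure_iUnion_fintype_le _ _).trans <| Finset.sum_le_sum fun s _ => h1 h s
      _ = ((N + 1 : ℕ) : ℝ≥0∞) * (1 / 4) ^ N := by
          simp only [Finset.sum_const, Finset.card_range, Finset.card_univ, Fintype.card_fun,
            Fintype.card_fin, nsmul_eq_mul, Nat.cast_pow]
          rw [← mul_pow]
          congr 2
          rw [← ENNReal.toReal_eq_toReal_iff' (by finiteness) (by finiteness)]
          norm_num
      _ ≤ 2 ^ N * (1 / 4) ^ N := by
          gcongr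
          exact_mod_cast Nat.lt_two_pow_self
      _ = (1 / 2) ^ N := by
          rw [← mul_pow]
          congr 1
          rw [← ENNReal.toReal_eq_toReal_iff' (by finiteness) (by finiteness)]
          norm_num
  have hsum : ∑' N, μ {ω | ω ∈ G N} ≠ ∞ := by
    refine ne_top_of_le_ne_top ?_ (ENNReal.tsum_le_tsum hG)
    rw [ENNReal.tsum_geometric]
    simp
  refine measure_mono_null ?_ (measure_setOfPred_frequently_eq_zero hsum)
  intro ω hω
  by_contra hfreq
  refine hω (exists_lipschitz_curve (B := {v | ω ∈ A v}) ?_)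
  rw [Set.mem_ofPred_eq, not_frequently] at hfreq
  obtain ⟨M, hM⟩ := eventually_atTop.1 hfreq
  filter_upwards [eventually_ge_atTop M] with h hh hr
  -- A path to height `h` has length `N ≥ h`, so reaching arbitrarily great heights would make `G N`
  -- occur infinitely often, against Borel–Cantelli.
  obtain ⟨N, hN, s, hc, hs⟩ := hr.exists_upSites
  refine hM N (by omega) ?_
  simp only [G, Set.mem_iUnion, Set.mem_iInter, Finset.mem_range]
  exact ⟨h, by omega, s, hc, fun v hv => hs hv⟩

end Lipschitz

/-! ### Coarse graining and the infinite component -/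

section CoarseGraining

variable {d S : ℕ}

/-- Two arms of length `n` and one of length `2 * n` in the coordinate plane, that meet at
`n • v`. -/
noncomputable def cross (d n : ℕ) (v : ℤ × ℤ) : Finset (Fin d → ℤ) :=
  ((Finset.range (n + 1)).image fun t : ℕ => emb d (n * v.1 + t) (n * v.2)) ∪
    (Finset.Icc (-n : ℤ) n).image fun t => emb d (n * v.1) (n * v.2 + t)

lemma card_cross_le {n : ℕ} (hn : 1 ≤ n) (v : ℤ × ℤ) : (cross d n v).card ≤ 5 * n := by
  refine (Finset.card_union_le _ _).trans ?_
  have h1 : ((Finset.range (n + 1)).image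
      fun t : ℕ => emb d (n * v.1 + t) (n * v.2)).card ≤ n + 1 :=
    Finset.card_image_le.trans_eq (Finset.card_range _)
  have h2 : ((Finset.Icc (-n : ℤ) n).image
      fun t => emb d (n * v.1) (n * v.2 + t)).card ≤ 2 * n + 1 := by
    refine Finset.card_image_le.trans ?_
    rw [Int.card_Icc]
    omega
  omega

lemma emb_fst_mem_cross {n : ℕ} {v : ℤ × ℤ} {t : ℕ} (ht : t ≤ n) :
    emb d (n * v.1 + t) (n * v.2) ∈ cross d n v :=
  Finset.mem_union_left _ (Finset.mem_image.2 ⟨t, by simpa using Nat.lt_succ_of_le ht, rfl⟩)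

lemma emb_snd_mem_cross {n : ℕ} {v : ℤ × ℤ} {b : ℤ} (h1 : n * v.2 - n ≤ b)
    (h2 : b ≤ n * v.2 + n) : emb d (n * v.1) b ∈ cross d n v :=
  Finset.mem_union_right _ (Finset.mem_image.2
    ⟨b - n * v.2, by rw [Finset.mem_Icc]; constructor <;> linarith, by simp⟩)

lemma dist_le_of_mem_cross {n : ℕ} {v : ℤ × ℤ} {x : Fin d → ℤ} (hx : x ∈ cross d n v) :
    dist (emb d (n * v.1) (n * v.2)) x ≤ n := by
  have h0 : (0 : ℝ) ≤ n := n.cast_nonneg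
  rcases Finset.mem_union.1 hx with h | h
  · obtain ⟨t, ht, rfl⟩ := Finset.mem_image.1 h
    have ht : (t : ℝ) ≤ n := by exact_mod_cast Nat.lt_succ_iff.1 (Finset.mem_range.1 ht)
    refine dist_emb_le h0 ?_ ?_ <;> simp [ht]
  · obtain ⟨t, ht, rfl⟩ := Finset.mem_image.1 h
    have ht : |(t : ℝ)| ≤ n := by exact_mod_cast abs_le.2 (Finset.mem_Icc.1 ht)
    refine dist_emb_le h0 ?_ ?_ <;> simp [ht]

/-- The vectors of sup norm at most `F`. -/
noncomputable def offsets (d F : ℕ) : Finset (Fin d → ℤ) := Fintype.piFinset fun _ => Finset.Icc (-F : ℤ) F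

lemma card_offsets (d F : ℕ) : (offsets d F).card = (2 * F + 1) ^ d := by
  rw [offsets, Fintype.card_piFinset]
  simp only [Int.card_Icc, Finset.prod_const, Finset.card_univ, Fintype.card_fin]
  congr 1
  omega

lemma mem_offsets {F : ℕ} {w : Fin d → ℤ} : w ∈ offsets d F ↔ ‖w‖ ≤ F := by
  rw [offsets, Fintype.mem_piFinset, pi_norm_le_iff_of_nonneg F.cast_nonneg]
  refine forall_congr' fun i => ?_
  rw [Finset.mem_Icc, ← abs_le, Int.norm_eq_abs]
  exact_mod_cast Iff.rfl

/-- The event that a site near the cross at `v` has an arm of length `n`. -/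
def badSite (S F n : ℕ) (v : ℤ × ℤ) : Set (Config d S) :=
  ⋃ x ∈ cross d n v, ⋃ w ∈ offsets d F, arm S n (x + w)

lemma law_badSite_le (p : I) {F n : ℕ} (hn : 1 ≤ n) (hS : S ≤ n) (v : ℤ × ℤ) :
    law d S p (badSite S F n v) ≤
      ((5 * n * (2 * F + 1) ^ d : ℕ) : ℝ≥0∞) * law d S p (arm S n 0) := by
  calc law d S p (badSite S F n v)
      ≤ ∑ x ∈ cross d n v, ∑ w ∈ offsets d F, law d S p (arm S n 0) :=
        (measure_biUnion_finset_le _ _).trans <| Finset.sum_le_sum fun x _ =>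
          (measure_biUnion_finset_le _ _).trans <| Finset.sum_le_sum fun w _ =>
            law_arm_le p hn hS _
    _ = (((cross d n v).card * (2 * F + 1) ^ d : ℕ) : ℝ≥0∞) * law d S p (arm S n 0) := by
        simp [card_offsets, mul_assoc]
    _ ≤ _ := by
        gcongr
        exact card_cross_le hn v

/-- The radius `4 * n` is made of `n` for the cross, `n` for the offset as `F ≤ n`, and `2 * n` for
the arm. -/
lemma dependsOn_badSite {F n : ℕ} (hn : 1 ≤ n) (hS : S ≤ n) (hF : F ≤ n) (v : ℤ × ℤ) :
    DependsOn (· ∈ badSite (d := d) S F n v)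
      (edgesIn d S (emb d (n * v.1) (n * v.2)) (4 * n) : Set (spreadOut d S).edgeSet) := by
  intro ω ω' h
  simp only [badSite, Set.mem_iUnion, exists_prop]
  refine propext (exists_congr fun x => and_congr_right fun hx => exists_congr fun w =>
    and_congr_right fun hw => (dependsOn_arm hn hS ?_ h).to_iff)
  have h1 := dist_le_of_mem_cross hx
  have h2 := mem_offsets.1 hw
  have h3 : (F : ℝ) ≤ n := by exact_mod_cast hF
  have h4 := dist_triangle (emb d (n * v.1) (n * v.2)) x (x + w)
  rw [dist_self_add_right] at h4
  linarith

lemma cross_subset_avoid {F n : ℕ} {v : ℤ × ℤ} {ω : Config d S} (h : ω ∉ badSite S F n v) :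
    (cross d n v : Set (Fin d → ℤ)) ⊆ avoid F ω := by
  rintro x hx ⟨y, hy, hxy⟩
  refine h ?_
  simp only [badSite, Set.mem_iUnion]
  refine ⟨x, hx, y - x, mem_offsets.2 ?_, ?_⟩
  · rwa [← dist_eq_norm, dist_comm]
  · rw [add_sub_cancel]
    exact mem_arm_of_mem_infSet hy n

/-- Distinct sites congruent modulo `9` differ by at least `9` in some coordinate, and `9 * n`
exceeds twice the dependence radius `4 * n`. -/
lemma lt_dist_emb_of_ne (hd : 2 ≤ d) {n : ℕ} (hn : 1 ≤ n) {v w : ℤ × ℤ} (hne : v ≠ w)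
    (h : ((v.1 : ZMod 9), (v.2 : ZMod 9)) = ((w.1 : ZMod 9), (w.2 : ZMod 9))) :
    2 * (4 * n : ℝ) < dist (emb d (n * v.1) (n * v.2)) (emb d (n * w.1) (n * w.2)) := by
  have hn' : (1 : ℝ) ≤ n := by exact_mod_cast hn
  have key : ∀ a b : ℤ, a ≠ b → (a : ZMod 9) = b →
      2 * (4 * n : ℝ) < |((n * a : ℤ) : ℝ) - ((n * b : ℤ) : ℝ)| := by
    intro a b hab hmod
    rw [ZMod.intCast_eq_intCast_iff_dvd_sub] at hmod
    have h9 : (9 : ℤ) ≤ |a - b| := by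
      rw [abs_sub_comm]
      exact Int.le_of_dvd (abs_pos.2 (sub_ne_zero.2 hab.symm)) ((dvd_abs _ _).2 hmod)
    have h9' : (9 : ℝ) ≤ |(a : ℝ) - b| := by exact_mod_cast h9
    push_cast
    rw [← mul_sub, abs_mul, Nat.abs_cast]
    nlinarith
  rw [Prod.mk.injEq] at h
  by_cases h1 : v.1 = w.1
  · refine (key _ _ (fun h2 => hne (Prod.ext h1 h2)) h.2).trans_le ?_
    exact_mod_cast abs_snd_le_dist_emb hd _ _ _ _
  · refine (key _ _ h1 h.1).trans_le ?_
    exact_mod_cast abs_fst_le_dist_emb hd _ _ _ _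

/-- By pigeonhole one of the `81` residue classes contains at least `T.card / 81` sites of `T`,
whose events are independent. The exponent `162 = 2 * 81` compensates for this loss. -/
lemma law_biInter_badSite_le (hd : 2 ≤ d) (p : I) {F n : ℕ} (hn : 1 ≤ n) (hS : S ≤ n)
    (hF : F ≤ n) (hq : ∀ v, law d S p (badSite S F n v) ≤ (1 / 12) ^ 162)
    (T : Finset (ℤ × ℤ)) :
    law d S p (⋂ v ∈ T, badSite S F n v) ≤ (1 / 12) ^ (2 * T.card) := by
  classical
  let φ : ℤ × ℤ → ZMod 9 × ZMod 9 := fun v => ((v.1 : ZMod 9), (v.2 : ZMod 9))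
  obtain ⟨c, -, hc⟩ : ∃ c ∈ (Finset.univ : Finset (ZMod 9 × ZMod 9)),
      T.card ≤ 81 * ({v ∈ T | φ v = c} : Finset (ℤ × ℤ)).card := by
    refine Finset.exists_le_of_sum_le Finset.univ_nonempty ?_
    rw [← Finset.mul_sum, ← Finset.card_eq_sum_card_fiberwise fun _ _ => Finset.mem_univ _]
    simp [ZMod.card]
  calc law d S p (⋂ v ∈ T, badSite S F n v)
      ≤ law d S p (⋂ v ∈ ({v ∈ T | φ v = c} : Finset (ℤ × ℤ)), badSite S F n v) :=
        measure_mono (Set.biInter_mono (fun v hv => (Finset.mem_filter.1 hv).1)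
          fun _ _ => subset_rfl)
    _ ≤ ((1 / 12) ^ 162) ^ ({v ∈ T | φ v = c} : Finset (ℤ × ℤ)).card := by
        refine measure_biInter_le_pow p _ _ (dependsOn_badSite hn hS hF) hq _ ?_
        intro v hv w hw hne
        refine disjoint_edgesIn (lt_dist_emb_of_ne hd hn hne ?_)
        exact (Finset.mem_filter.1 hv).2.trans (Finset.mem_filter.1 hw).2.symm
    _ ≤ (1 / 12) ^ (2 * T.card) := by
        rw [← pow_mul]
        exact pow_le_pow_of_le_one zero_le (by simp) (by omega)

/-- The sites `x` and `y` are joined by a lattice path in `X`. -/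
def Joined (X : Set (Fin d → ℤ)) (x y : Fin d → ℤ) : Prop :=
  ∃ (hx : x ∈ X) (hy : y ∈ X), ((lattice d).induce X).Reachable ⟨x, hx⟩ ⟨y, hy⟩

lemma Joined.symm {X : Set (Fin d → ℤ)} {x y : Fin d → ℤ} (h : Joined X x y) : Joined X y x := by
  obtain ⟨hx, hy, h⟩ := h
  exact ⟨hy, hx, h.symm⟩

lemma Joined.trans {X : Set (Fin d → ℤ)} {x y z : Fin d → ℤ} (h : Joined X x y)
    (h' : Joined X y z) : Joined X x z := by
  obtain ⟨hx, _, h⟩ := h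
  obtain ⟨_, hz, h'⟩ := h'
  exact ⟨hx, hz, h.trans h'⟩

lemma joined_of_adj_succ {X : Set (Fin d → ℤ)} (f : ℕ → Fin d → ℤ) (k : ℕ)
    (hadj : ∀ i, (lattice d).Adj (f i) (f (i + 1))) (hX : ∀ i ≤ k, f i ∈ X) :
    Joined X (f 0) (f k) := by
  induction k with
  | zero => exact ⟨hX 0 le_rfl, hX 0 le_rfl, .refl _⟩
  | succ k ih =>
    refine (ih fun i hi => hX i (by omega)).trans ⟨hX k (by omega), hX (k + 1) le_rfl, ?_⟩
    exact SimpleGraph.Adj.reachable (SimpleGraph.induce_adj.2 (hadj k))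

lemma joined_snd (hd : 2 ≤ d) {X : Set (Fin d → ℤ)} {a b b' : ℤ} (hb : b ≤ b')
    (hX : ∀ t, b ≤ t → t ≤ b' → emb d a t ∈ X) : Joined X (emb d a b) (emb d a b') := by
  have := joined_of_adj_succ (X := X) (fun i => emb d a (b + i)) (b' - b).toNat
    (fun i => by simpa [add_assoc] using lattice_adj_emb_snd hd a (b + i))
    (fun i hi => hX _ (by omega) (by omega))
  simpa [Int.toNat_of_nonneg (sub_nonneg.2 hb)] using this

lemma joined_fst (hd : 2 ≤ d) {X : Set (Fin d → ℤ)} {a b : ℤ} (k : ℕ)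
    (hX : ∀ t ≤ k, emb d (a + t) b ∈ X) : Joined X (emb d a b) (emb d (a + k) b) := by
  have := joined_of_adj_succ (X := X) (fun i => emb d (a + i) b) k
    (fun i => by simpa [add_assoc] using lattice_adj_emb_fst hd (a + i) b) hX
  simpa using this

/-- The horizontal arm of the first cross ends in the column of the second. It meets the vertical
arms there, which extend `n` both ways, because the heights differ by at most `n`. -/
lemma joined_cross (hd : 2 ≤ d) {X : Set (Fin d → ℤ)} {n : ℕ} {x y y' : ℤ}
    (hy : |y - y'| ≤ 1) (h : (cross d n (x, y) : Set (Fin d → ℤ)) ⊆ X)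
    (h' : (cross d n (x + 1, y') : Set (Fin d → ℤ)) ⊆ X) :
    Joined X (emb d (n * x) (n * y)) (emb d (n * (x + 1)) (n * y')) := by
  have h1 : Joined X (emb d (n * x) (n * y)) (emb d (n * (x + 1)) (n * y)) := by
    rw [mul_add_one]
    exact joined_fst hd n fun t ht => h (emb_fst_mem_cross ht)
  refine h1.trans ?_
  have h0 : (0 : ℤ) ≤ n := n.cast_nonneg
  rw [abs_le] at hy
  rcases le_total y y' with hle | hle
  · refine joined_snd hd (by nlinarith) fun t ht ht' => h' (emb_snd_mem_cross ?_ ?_)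
    · dsimp only
      nlinarith
    · dsimp only
      linarith
  · refine (joined_snd hd (by nlinarith) fun t ht ht' => h' (emb_snd_mem_cross ?_ ?_)).symm
    · dsimp only
      linarith
    · dsimp only
      nlinarith

lemma mem_finEvent_of_lipschitz_curve (hd : 2 ≤ d) {F n : ℕ} (hn : 1 ≤ n) {ω : Config d S}
    {L : ℕ → ℤ} (hL : ∀ x : ℕ, ω ∉ badSite S F n (x, L x) ∧ |L x - L (x + 1)| ≤ 1) :
    ω ∈ finEvent d S F := by
  have hj : ∀ x : ℕ, Joined (avoid F ω) (emb d (n * (0 : ℕ)) (n * L 0))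
      (emb d (n * x) (n * L x)) := by
    intro x
    induction x with
    | zero =>
      have h0 := cross_subset_avoid (hL 0).1 (emb_fst_mem_cross (t := 0) (Nat.zero_le n))
      have h1 : emb d (n * (0 : ℕ)) (n * L 0) ∈ avoid F ω := by simpa using h0
      exact ⟨h1, h1, .refl _⟩
    | succ x ih =>
      have := joined_cross hd (hL x).2 (cross_subset_avoid (hL x).1)
        (by exact_mod_cast cross_subset_avoid (hL (x + 1)).1)
      exact ih.trans (by exact_mod_cast this)
  choose h0 hx hreach using hj
  refine ⟨((lattice d).induce (avoid F ω)).connectedComponentMk ⟨_, h0 0⟩, ?_⟩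
  refine Set.infinite_of_injective_forall_mem (f := fun x : ℕ => (⟨_, hx x⟩ : avoid F ω)) ?_
    fun x => ?_
  · intro x y hxy
    have h1 := congrFun (congrArg Subtype.val hxy) ⟨0, by omega⟩
    have hn0 : n ≠ 0 := by omega
    simpa [emb, hn0] using h1
  · rw [SimpleGraph.ConnectedComponent.mem_supp_iff, SimpleGraph.ConnectedComponent.eq]
    exact (hreach x).symm

lemma law_finEvent_pos (hd : 2 ≤ d) (p : I) {F n : ℕ} (hn : 1 ≤ n) (hS : S ≤ n)
    (hF : F ≤ n) (hq : ∀ v, law d S p (badSite S F n v) ≤ (1 / 12) ^ 162) :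
    0 < law d S p (finEvent d S F) := by
  have h := measure_not_exists_lipschitz_curve (law d S p) _
    (law_biInter_badSite_le hd p hn hS hF hq)
  rw [pos_iff_ne_zero]
  -- Arguing with null sets avoids any need for measurability of `finEvent`.
  intro h0
  have huniv : law d S p Set.univ = 0 := by
    refine measure_mono_null ?_ (measure_union_null h0 h)
    intro ω _
    by_cases hω : ∃ L : ℕ → ℤ, ∀ x : ℕ,
        ω ∉ badSite S F n (x, L x) ∧ |L x - L (x + 1)| ≤ 1
    · obtain ⟨L, hL⟩ := hω
      exact Or.inl (mem_finEvent_of_lipschitz_curve hd hn hL)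
    · exact Or.inr hω
  simp at huniv

end CoarseGraining

end Perc

theorem mainTheorem3 (d : ℕ) (hd : 2 ≤ d) (S F : ℕ) :
    ∃ c : ℝ, 0 < c ∧
      ((∀ᶠ n : ℕ in atTop,
          (Perc.law d S (Perc.pc d S)).real {ω | (n : ℝ≥0∞) ≤ Perc.rad ω} ≤ c / n) →
        Perc.pc d S < Perc.pfin d S F) := by
  have hK : (1 : ℝ) ≤ (2 * F + 1) ^ d := one_le_pow₀ (by linarith [F.cast_nonneg (α := ℝ)])
  -- The union bound has at most `5 * n * (2 * F + 1) ^ d` arms, each of probability at most `2 * c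
  -- / n`. This `c` makes the product equal to `(1 / 12) ^ 162`.
  refine ⟨(1 / 12) ^ 162 / (10 * (2 * F + 1) ^ d), by positivity, fun hev => ?_⟩
  set c : ℝ := (1 / 12) ^ 162 / (10 * (2 * F + 1) ^ d) with hc
  have hc0 : 0 < c := by positivity
  have hc1 : c < 1 := by
    rw [hc, div_lt_one (by positivity)]
    calc ((1 : ℝ) / 12) ^ 162 ≤ 1 := pow_le_one₀ (by norm_num) (by norm_num)
      _ < 10 * (2 * F + 1) ^ d := by linarith
  obtain ⟨n, hn, hn1⟩ := (hev.and (eventually_ge_atTop (1 + S + F))).exists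
  have hn' : (1 : ℝ) ≤ n := by exact_mod_cast (by omega : 1 ≤ n)
  have harm : (Perc.law d S (Perc.pc d S)).real (Perc.arm S n 0) ≤ c / n :=
    (measureReal_mono (Perc.arm_subset_rad n)).trans hn
  have hpc : Perc.pc d S < 1 := by
    refine lt_of_le_of_ne unitInterval.le_one' fun h => ?_
    rw [h, Perc.law_one_arm hd, le_div_iff₀ (by linarith)] at harm
    linarith
  -- The factor `2` is the slack that lets continuity move the bound to some `p > p_c` at this fixed
  -- `n`.
  have hlt : c / n < 2 * c / n := by
    gcongr
    linarith
  have hcont := (Perc.continuous_law_arm (d := d) (S := S) (n := n) (by omega) (by omega) 0).tendsto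
    (Perc.pc d S)
  have : (𝓝[>] (Perc.pc d S)).NeBot := nhdsGT_neBot_of_exists_gt ⟨1, hpc⟩
  obtain ⟨p, hp, hpgt⟩ := (((hcont.eventually (gt_mem_nhds (harm.trans_lt hlt))).filter_mono
    nhdsWithin_le_nhds).and (self_mem_nhdsWithin (s := Set.Ioi (Perc.pc d S)))).exists
  refine lt_of_lt_of_le hpgt (le_sSup ?_)
  refine Perc.law_finEvent_pos hd p (n := n) (by omega) (by omega) (by omega) fun v => ?_
  refine (Perc.law_badSite_le p (by omega) (by omega) v).trans ?_
  rw [← ENNReal.toReal_le_toReal (by finiteness) (by finiteness), ENNReal.toReal_mul]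
  change _ * (Perc.law d S p).real _ ≤ _
  calc _ ≤ ((5 * n * (2 * F + 1) ^ d : ℕ) : ℝ≥0∞).toReal * (2 * c / n) := by gcongr
    _ = 10 * (2 * F + 1) ^ d * c := by
        rw [ENNReal.toReal_natCast]
        push_cast
        field_simp
        ring
    _ = (1 / 12) ^ 162 := by
        rw [hc]
        field_simp
    _ = _ := by simp
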